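/- Let $k$ be an algebraically closed field. A variety over $k$ is a reduced, separated, possibly reducible scheme of finite type over $k$, and a point of a variety means a closed point. Let $X, Y, S$ be varieties over $k$, and let $f\colon X\to Y$, $g\colon X\to S$, $h\colon Y\to S$ be morphisms of varieties over $k$ with $g=h\circ f$. Let $d\ge 1$ be an integer. Assume: (a) $h\colon Y\to S$ is smooth of relative dimension $d$; (b) $f$ is finite and surjective; (c) for every point $s\in h(Y)$ the fiber $g^{-1}(s)$ is irreducible, and there is a point $x\in g^{-1}(s)$ such that $g$ is smooth at $x$; (d) for every point $s\in g(X)=h(Y)$ the morphism $f_s\colon g^{-1}(s)\to h^{-1}(s)$ induced by $f$ is birational, i.e. it restricts to an isomorphism from a dense open subset of $g^{-1}(s)$ onto a dense open subset of $h^{-1}(s)$, the fibers being taken with their reduced scheme structures. Then $f\colon X\to Y$ is an isomorphism. -/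

import Mathlib

open AlgebraicGeometry CategoryTheory

universe u

namespace FiberwiseBirational

/-- A variety over the field `k`, given by its structure morphism: a reduced, separated scheme of
finite type over `k`, possibly reducible. -/
structure IsVariety {k : Type u} [Field k] {X : Scheme.{u}} (p : X ⟶ Spec (.of k)) : Prop where
  isReduced : IsReduced X
  isSeparated : IsSeparated p
  locallyOfFiniteType : LocallyOfFiniteType p
  quasiCompact : QuasiCompact p

/-- `g` is smooth at `x`: it is a smooth morphism on some open neighbourhood of `x`. -/
def SmoothAt {X S : Scheme.{u}} (g : X ⟶ S) (x : X) : Prop :=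
  ∃ U : X.Opens, x ∈ U ∧ Smooth (U.ι ≫ g)

/-- The fiber over a closed point, as a closed subset. -/
def fiberClosed {X S : Scheme.{u}} (g : X ⟶ S) (s : S) (hs : IsClosed ({s} : Set S)) :
    TopologicalSpace.Closeds X :=
  ⟨g ⁻¹' {s}, hs.preimage g.continuous⟩

/-- The fiber `g⁻¹(s)` over a closed point `s`, as a variety: the closed subset with its reduced
induced scheme structure. -/
noncomputable def fiber {X S : Scheme.{u}} (g : X ⟶ S) (s : S) (hs : IsClosed ({s} : Set S)) :
    Scheme.{u} :=
  (Scheme.IdealSheafData.vanishingIdeal (fiberClosed g s hs)).subscheme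

theorem vanishingIdeal_fiber_le {X Y S : Scheme.{u}} (f : X ⟶ Y) (g : X ⟶ S) (h : Y ⟶ S)
    (w : f ≫ h = g) (s : S) (hs : IsClosed ({s} : Set S)) :
    Scheme.IdealSheafData.vanishingIdeal (fiberClosed h s hs) ≤
      (Scheme.IdealSheafData.vanishingIdeal (fiberClosed g s hs)).map f := by
  rw [Scheme.IdealSheafData.map_vanishingIdeal]
  apply Scheme.IdealSheafData.vanishingIdeal_antimono
  change closure (f '' (g ⁻¹' {s})) ⊆ h ⁻¹' {s}
  refine closure_minimal ?_ (hs.preimage h.continuous)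
  rintro _ ⟨x, hx, rfl⟩
  subst w
  simpa using hx

/-- The morphism `f_s : g⁻¹(s) ⟶ h⁻¹(s)` induced by `f`. -/
noncomputable def fiberMap {X Y S : Scheme.{u}} (f : X ⟶ Y) (g : X ⟶ S) (h : Y ⟶ S)
    (w : f ≫ h = g) (s : S) (hs : IsClosed ({s} : Set S)) : fiber g s hs ⟶ fiber h s hs :=
  Scheme.IdealSheafData.subschemeMap _ _ f (vanishingIdeal_fiber_le f g h w s hs)

/-- A morphism is birational if it restricts to an isomorphism from a dense open subscheme of the
source onto a dense open subscheme of the target. -/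
def IsBirational {A B : Scheme.{u}} (φ : A ⟶ B) : Prop :=
  ∃ p : Scheme.PartialIso A B, p.iso.hom ≫ p.target.ι = p.source.ι ≫ φ

end FiberwiseBirational

/-! Since `Y` is reduced and `f` is surjective, `O_Y → f_* O_X` is injective, so the task is to show
that every section `b` upstairs comes from `Y`.

Near generic points of fibers: let `ξ` be the generic point of a closed fiber of `g`. Smoothness at
`ξ` makes the scheme-theoretic fiber reduced there, birationality makes the residue extension at `ξ`
trivial, and incomparability makes `ξ` the only point over `f ξ`. Nakayama then yields a function
`t` on `Y`, nonzero at `f ξ`, with `t * b` in `O_Y` for all `b` (`exists_notMem_mul_mem_range`).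

From there to everywhere: `h` is open, so after shrinking `S` the locus `t ≠ 0` meets every fiber.
Then `t` is regular on every closed fiber of `h`, hence regular after tensoring with any `R`-module,
where `R` is the coordinate ring of the base (`rTensor_mulLeft_injective`). Now `b = a / t` is
integral over the smooth `R`-algebra `A` of functions on `Y`. Although `A` need not be normal, it
contains such quotients (`dvd_of_smooth`): they exist over the residue fields at the minimal primes
of `R`, descend to the integral closure of `R` because integral closure commutes with smooth base
change, and then to `R` because `t` stays injective on the quotient module. -/

namespace FiberwiseBirational

open TensorProduct

/-! ### Étale algebras over normal domains and smooth algebras over fields -/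

/-- An element of the form `c` with `t * c = a`, where `t` is regular and `a` satisfies the equation
of integral dependence for `a / t`, is integral. -/
theorem isIntegral_of_scaleRoots_eval_eq_zero {A L : Type*} [CommRing A] [CommRing L] [Algebra A L]
    {p : Polynomial A} (hp : p.Monic) {t a : A} (hpa : (p.scaleRoots t).eval a = 0) {c : L}
    (hc : algebraMap A L t * c = algebraMap A L a)
    (ht : IsLeftRegular (algebraMap A L t)) : IsIntegral A c := by
  refine ⟨p, hp, ?_⟩
  have h1 := Polynomial.scaleRoots_eval₂_mul (p := p) (algebraMap A L) c t
  rw [hc, Polynomial.eval₂_at_apply, hpa, map_zero] at h1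
  exact (ht.pow p.natDegree).eq_iff.mp (by simpa using h1.symm)

theorem isReduced_of_etale (E A : Type*) [CommRing E] [IsDomain E] [CommRing A] [Algebra E A]
    [Algebra.Etale E A] : IsReduced A := by
  have : IsReduced (FractionRing E ⊗[E] A) :=
    Algebra.FormallyUnramified.isReduced_of_field (FractionRing E) _
  exact isReduced_of_injective (Algebra.TensorProduct.includeRight : A →ₐ[E] FractionRing E ⊗[E] A)
    (Algebra.TensorProduct.includeRight_injective (IsFractionRing.injective E (FractionRing E)))

/-- Over the fraction field `F` the algebra becomes Artinian, so the regular element `t` is a unit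
and `a / t` exists in `A ⊗ F`. It is integral over `A`, and integral closure commutes with smooth
base change, so it lies in `A ⊗ E = A`. -/
theorem dvd_of_etale (E : Type*) {A : Type*} [CommRing E] [IsDomain E] [IsIntegrallyClosed E]
    [CommRing A] [Algebra E A] [Algebra.Etale E A] {p : Polynomial A} (hp : p.Monic) {t a : A}
    (ht : IsLeftRegular t) (hpa : (p.scaleRoots t).eval a = 0) : t ∣ a := by
  let F := FractionRing E
  have hfin : Module.Finite F (F ⊗[E] A) := Algebra.FormallyUnramified.finite_of_free _ _
  have hart : IsArtinianRing (F ⊗[E] A) := IsArtinianRing.of_finite F _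
  have hreg : IsLeftRegular ((1 : F) ⊗ₜ[E] t) := by
    have h1 := Module.Flat.lTensor_preserves_injective_linearMap (M := F)
      (LinearMap.mulLeft E t) ht
    intro x y hxy
    apply h1
    have h2 : ∀ z : F ⊗[E] A, (LinearMap.lTensor F (LinearMap.mulLeft E t)) z = (1 ⊗ₜ t) * z := by
      intro z
      induction z with
      | zero => simp
      | add x y hx hy => simp only [map_add, hx, hy, mul_add]
      | tmul x y => simp
    rw [h2, h2]; exact hxy
  have hunit : IsUnit ((1 : F) ⊗ₜ[E] t) :=
    IsArtinianRing.isUnit_of_mem_nonZeroDivisors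
      (mem_nonZeroDivisors_iff_right.mpr fun x hx => hreg (by simpa [mul_comm] using hx))
  have hunit' : IsUnit (algebraMap A (A ⊗[E] F) t) := by
    have := hunit.map (Algebra.TensorProduct.comm E F A)
    simpa using this
  obtain ⟨v, hv⟩ := hunit'.exists_right_inv
  set c : A ⊗[E] F := v * algebraMap A (A ⊗[E] F) a with hc
  have hc' : algebraMap A (A ⊗[E] F) t * c = algebraMap A (A ⊗[E] F) a := by
    rw [hc, ← mul_assoc, hv, one_mul]
  have hint : IsIntegral A c :=
    isIntegral_of_scaleRoots_eval_eq_zero hp hpa hc' hunit'.isRegular.left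
  obtain ⟨y, hy⟩ := (TensorProduct.toIntegralClosure_bijective_of_smooth (R := E) (S := A)
    (B := F)).2 ⟨c, hint⟩
  have hrange : ∀ y : A ⊗[E] integralClosure E F,
      ∃ a' : A, ((TensorProduct.toIntegralClosure E A F y : integralClosure A (A ⊗[E] F)) :
        A ⊗[E] F) = algebraMap A (A ⊗[E] F) a' := by
    intro y
    induction y with
    | zero => exact ⟨0, by simp⟩
    | add x y hx hy =>
      obtain ⟨x', hx⟩ := hx
      obtain ⟨y', hy⟩ := hy
      exact ⟨x' + y', by simp [hx, hy]⟩
    | tmul x y =>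
      obtain ⟨y, hy⟩ := y
      have hy' := hy
      rw [IsIntegrallyClosed.integralClosure_eq_bot] at hy'
      obtain ⟨e, rfl⟩ := Algebra.mem_bot.mp hy'
      refine ⟨e • x, ?_⟩
      simp [TensorProduct.toIntegralClosure, Algebra.algebraMap_eq_smul_one,
        Algebra.TensorProduct.one_def, TensorProduct.smul_tmul']
  obtain ⟨a', ha'⟩ := hrange y
  rw [hy] at ha'
  refine ⟨a', ?_⟩
  apply Algebra.TensorProduct.includeLeft_injective (R := E) (S := A) (A := A) (B := F)
    (IsFractionRing.injective E F)
  have := hc'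
  simp only at ha'
  rw [ha', ← map_mul] at this
  exact this.symm

/-- The integral closure of a smooth algebra over a field in its localisations at regular elements
is trivial. -/
theorem dvd_of_smooth_of_field (K : Type*) {A : Type*} [Field K] [CommRing A] [Algebra K A]
    [Algebra.Smooth K A] {p : Polynomial A} (hp : p.Monic) {t a : A}
    (ht : IsLeftRegular t) (hpa : (p.scaleRoots t).eval a = 0) : t ∣ a := by
  -- Divisibility is local: the ideal of multipliers carrying `a` into `(t)` is shown to lie in no
  -- maximal ideal, using a neighbourhood étale over an affine space.
  suffices h : (Ideal.span {t}).colon {a} = ⊤ by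
    have : (1 : A) ∈ (Ideal.span {t}).colon {a} := h ▸ Submodule.mem_top
    rw [Submodule.mem_colon_singleton] at this
    simpa [Ideal.mem_span_singleton] using this
  by_contra h
  obtain ⟨m, hm, hle⟩ := Ideal.exists_le_maximal _ h
  obtain ⟨f, hfm, n, _, _, _⟩ :=
    Algebra.IsSmoothAt.exists_isStandardEtale_mvPolynomial (R := K) (p := m)
  let Af := Localization.Away f
  have hdvd : algebraMap A Af t ∣ algebraMap A Af a := by
    refine dvd_of_etale (MvPolynomial (Fin n) K) (p := p.map (algebraMap A Af)) (hp.map _) ?_ ?_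
    · rw [isLeftRegular_iff_right_eq_zero_of_mul] at ht ⊢
      have h1 := IsLocalization.map_nonZeroDivisors_le (Submonoid.powers f) Af
        ⟨t, mem_nonZeroDivisors_iff_left.mpr ht, rfl⟩
      exact mem_nonZeroDivisors_iff_left.mp h1
    · by_cases hA : Nontrivial Af
      · rw [← Polynomial.map_scaleRoots _ _ _ (by simp [hp.leadingCoeff]),
          Polynomial.eval_map, Polynomial.eval₂_at_apply, hpa, map_zero]
      · rw [not_nontrivial_iff_subsingleton] at hA
        exact Subsingleton.elim _ _
  obtain ⟨z, hz⟩ := hdvd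
  obtain ⟨⟨z', s⟩, hs⟩ := IsLocalization.surj (Submonoid.powers f) z
  obtain ⟨k, hk⟩ := s.2
  have h2 : algebraMap A Af (f ^ k * a) = algebraMap A Af (t * z') := by
    simp only at hs
    rw [map_mul, map_mul, ← hs, ← hk, hz]; ring
  obtain ⟨⟨_, l, rfl⟩, hl⟩ := (IsLocalization.eq_iff_exists (Submonoid.powers f) Af).mp h2
  have : f ^ (l + k) ∈ (Ideal.span {t}).colon {a} := by
    rw [Submodule.mem_colon_singleton, Ideal.mem_span_singleton]
    refine ⟨f ^ l * z', ?_⟩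
    simp only at hl
    rw [smul_eq_mul, pow_add, mul_assoc, hl]; ring
  exact hfm (hm.isPrime.mem_of_pow_mem _ (hle this))

theorem isReduced_of_smooth_of_field (K A : Type*) [Field K] [CommRing A] [Algebra K A]
    [Algebra.Smooth K A] : IsReduced A := by
  refine ⟨fun x hx => ?_⟩
  suffices h : Ideal.span {x} = ⊥ by simpa using h
  by_contra h
  have h' : (⊥ : Ideal A).colon {x} ≠ ⊤ := by
    intro h1
    have : (1 : A) ∈ (⊥ : Ideal A).colon {x} := h1 ▸ Submodule.mem_top
    rw [Submodule.mem_colon_singleton] at this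
    apply h
    simpa using this
  obtain ⟨m, hm, hle⟩ := Ideal.exists_le_maximal _ h'
  obtain ⟨f, hfm, n, _, _, _⟩ :=
    Algebra.IsSmoothAt.exists_isStandardEtale_mvPolynomial (R := K) (p := m)
  have := isReduced_of_etale (MvPolynomial (Fin n) K) (Localization.Away f)
  have h2 : algebraMap A (Localization.Away f) x = algebraMap A _ 0 := by
    rw [map_zero]; exact (hx.map _).eq_zero
  obtain ⟨⟨_, l, rfl⟩, hl⟩ := (IsLocalization.eq_iff_exists (Submonoid.powers f) _).mp h2
  refine hfm (hm.isPrime.mem_of_pow_mem l (hle ?_))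
  rw [Submodule.mem_colon_singleton]
  simpa using hl

/-! ### Elements regular after tensoring with every module -/

section UniversallyRegular

variable {R A : Type*} [CommRing R] [CommRing A] [Algebra R A]

theorem rTensor_mulLeft_apply {N : Type*} [AddCommGroup N] [Module R N] (t : A) (x : A ⊗[R] N) :
    (LinearMap.mulLeft R t).rTensor N x = t • x := by
  induction x with
  | zero => simp
  | add x y hx hy => rw [map_add, hx, hy, smul_add]
  | tmul x y => simp [TensorProduct.smul_tmul']

/-- Here `N` is a vector space over `R ⧸ m`, so `A ⊗ N` is the base change of `A / mA` along a flat
module, and injectivity on `A / mA` suffices. -/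
theorem rTensor_mulLeft_injective_of_isTorsionBySet {m : Ideal R} [m.IsMaximal] {t : A}
    (ht : ∀ x : A, t * x ∈ m.map (algebraMap R A) → x ∈ m.map (algebraMap R A))
    {N : Type*} [AddCommGroup N] [Module R N] (hN : Module.IsTorsionBySet R N m) :
    Function.Injective ((LinearMap.mulLeft R t).rTensor N) := by
  let := hN.module
  let := Ideal.Quotient.field m
  have : IsScalarTower R (R ⧸ m) N := hN.isScalarTower
  rw [← LinearMap.lTensor_inj_iff_rTensor_inj]
  have h1 : Function.Injective ((LinearMap.mulLeft R t).baseChange (R ⧸ m)) := by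
    rw [injective_iff_map_eq_zero]
    intro x hx
    let e := (Algebra.TensorProduct.comm R (R ⧸ m) A).toRingEquiv.trans
      (Algebra.TensorProduct.quotIdealMapEquivTensorQuot A m).symm.toRingEquiv
    have he : ∀ a : A, e (1 ⊗ₜ a) = Ideal.Quotient.mk _ a := fun a => by
      exact (Algebra.TensorProduct.quotIdealMapEquivTensorQuot A m).symm_apply_eq.mpr
        (Algebra.TensorProduct.quotIdealMapEquivTensorQuot_mk A m a).symm
    obtain ⟨a, ha⟩ := Ideal.Quotient.mk_surjective (e x)
    obtain rfl : 1 ⊗ₜ a = x := e.injective (by rw [he, ha])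
    rw [LinearMap.baseChange_tmul] at hx
    have h0 := congrArg e hx
    rw [he, map_zero, Ideal.Quotient.eq_zero_iff_mem] at h0
    apply e.injective
    rw [he, map_zero, Ideal.Quotient.eq_zero_iff_mem]
    exact ht a h0
  have h2 := Module.Flat.lTensor_preserves_injective_linearMap (M := N) _ h1
  let e := TensorProduct.AlgebraTensorModule.cancelBaseChange R (R ⧸ m) (R ⧸ m) N A
  have h3 : ∀ x : N ⊗[R ⧸ m] ((R ⧸ m) ⊗[R] A),
      (LinearMap.mulLeft R t).lTensor N (e x) =
        e (((LinearMap.mulLeft R t).baseChange (R ⧸ m)).lTensor N x) := by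
    intro x
    induction x with
    | zero => simp
    | add x y hx hy => simp only [map_add, hx, hy]
    | tmul x y =>
      induction y with
      | zero => simp
      | add y z hy hz => simp only [map_add, tmul_add, hy, hz]
      | tmul y z => simp [e]
  intro x y hxy
  obtain ⟨x, rfl⟩ := e.surjective x
  obtain ⟨y, rfl⟩ := e.surjective y
  rw [h3, h3] at hxy
  rw [h2 (e.injective hxy)]

/-- Dévissage along `0 → mN → N → N/mN → 0`, which stays exact on tensoring with the flat algebra
`A`. -/
theorem rTensor_mulLeft_injective_of_pow_smul_top_eq_bot [Module.Flat R A]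
    {m : Ideal R} [m.IsMaximal] {t : A}
    (ht : ∀ x : A, t * x ∈ m.map (algebraMap R A) → x ∈ m.map (algebraMap R A))
    (n : ℕ) {N : Type*} [AddCommGroup N] [Module R N] (hN : m ^ n • (⊤ : Submodule R N) = ⊥) :
    Function.Injective ((LinearMap.mulLeft R t).rTensor N) := by
  induction n generalizing N with
  | zero =>
    have : Subsingleton N := by
      rw [← Submodule.subsingleton_iff R, ← subsingleton_iff_bot_eq_top]
      simpa using hN.symm
    exact Function.injective_of_subsingleton _
  | succ n ih =>
    let N' : Submodule R N := m • ⊤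
    have h1 : Function.Injective ((LinearMap.mulLeft R t).rTensor N') := by
      apply ih
      apply Submodule.map_injective_of_injective N'.injective_subtype
      rw [Submodule.map_smul'', Submodule.map_top, Submodule.range_subtype, Submodule.map_bot, ← hN,
        pow_succ, Submodule.mul_smul]
    have h2 : Function.Injective ((LinearMap.mulLeft R t).rTensor (N ⧸ N')) := by
      apply rTensor_mulLeft_injective_of_isTorsionBySet ht
      exact Module.isTorsionBySet_quotient_ideal_smul N m
    rw [injective_iff_map_eq_zero] at h1 h2 ⊢
    intro x hx
    have hx' : t • x = 0 := by rw [← rTensor_mulLeft_apply]; exact hx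
    have hex := lTensor_exact A (LinearMap.exact_subtype_mkQ N') N'.mkQ_surjective
    have h3 : (N'.mkQ.lTensor A) x = 0 := by
      apply h2
      rw [← LinearMap.comp_apply, LinearMap.rTensor_comp_lTensor, ← LinearMap.lTensor_comp_rTensor,
        LinearMap.comp_apply, hx, map_zero]
    obtain ⟨y, rfl⟩ := (hex x).mp h3
    have h4 := Module.Flat.lTensor_preserves_injective_linearMap (M := A) _ N'.injective_subtype
    rw [h1 y, map_zero]
    apply h4
    rw [map_zero, ← hx, ← LinearMap.comp_apply, ← LinearMap.comp_apply,
      LinearMap.rTensor_comp_lTensor, LinearMap.lTensor_comp_rTensor]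

theorem range_lTensor_subtype_le (I : Ideal R) (N : Type*) [AddCommGroup N] [Module R N]
    (x : A ⊗[R] (I • ⊤ : Submodule R N)) :
    (I • ⊤ : Submodule R N).subtype.lTensor A x ∈
      (I.map (algebraMap R A) • ⊤ : Submodule A (A ⊗[R] N)) := by
  induction x with
  | zero => simp
  | add x y hx hy => rw [map_add]; exact add_mem hx hy
  | tmul a y =>
    obtain ⟨y, hy⟩ := y
    simp only [LinearMap.lTensor_tmul, Submodule.subtype_apply]
    induction hy using Submodule.smul_induction_on' with
    | smul r hr n hn =>
      have : a ⊗ₜ[R] (r • n) = algebraMap R A r • (a ⊗ₜ[R] n) := by simp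
      rw [this]
      exact Submodule.smul_mem_smul (Ideal.mem_map_of_mem _ hr) trivial
    | add x hx y hy h1 h2 => rw [tmul_add]; exact add_mem h1 h2

/-- If multiplication by `t` is injective on the fibres of `A` over the closed points of `Spec R`,
then it is universally injective. -/
theorem rTensor_mulLeft_injective [IsNoetherianRing R] [IsNoetherianRing A] [Module.Flat R A]
    (hmax : ∀ P : Ideal A, P.IsMaximal → (P.comap (algebraMap R A)).IsMaximal) {t : A}
    (ht : ∀ m : Ideal R, m.IsMaximal → ∀ x : A,
      t * x ∈ m.map (algebraMap R A) → x ∈ m.map (algebraMap R A))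
    (N : Type*) [AddCommGroup N] [Module R N] :
    Function.Injective ((LinearMap.mulLeft R t).rTensor N) := by
  wlog hfin : Module.Finite R N generalizing N
  · rw [injective_iff_map_eq_zero]
    intro x hx
    obtain ⟨N', h', hx'⟩ := TensorProduct.exists_finite_submodule_right_of_setFinite {x}
      (Set.finite_singleton x)
    obtain ⟨y, rfl⟩ := hx' rfl
    have h4 := Module.Flat.lTensor_preserves_injective_linearMap (M := A) _ N'.injective_subtype
    rw [(injective_iff_map_eq_zero _).mp (this N' h') y, map_zero]
    apply h4
    rw [map_zero, ← hx, ← LinearMap.comp_apply, ← LinearMap.comp_apply,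
      LinearMap.rTensor_comp_lTensor, LinearMap.lTensor_comp_rTensor]
  rw [injective_iff_map_eq_zero]
  intro x hx
  by_contra hx0
  -- Injectivity on each `N / m ^ n N` puts `x` in every `m ^ n (A ⊗ N)`. Krull's intersection
  -- theorem gives `r ∈ mA ⊆ P` with `r x = x`, so `1 - r` annihilates `x` and also lies in `P`,
  -- which is absurd.
  obtain ⟨P, hP, hle⟩ := Ideal.exists_le_maximal (Ideal.torsionOf A _ x)
    (by rwa [Ne, Ideal.torsionOf_eq_top_iff])
  have hm := hmax P hP
  set m := P.comap (algebraMap R A)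
  have h1 : x ∈ (⨅ i : ℕ, (m.map (algebraMap R A)) ^ i • ⊤ : Submodule A (A ⊗[R] N)) := by
    rw [Submodule.mem_iInf]
    intro n
    let N' : Submodule R N := m ^ n • ⊤
    have hex := lTensor_exact A (LinearMap.exact_subtype_mkQ N') N'.mkQ_surjective
    have h2 : Function.Injective ((LinearMap.mulLeft R t).rTensor (N ⧸ N')) := by
      apply rTensor_mulLeft_injective_of_pow_smul_top_eq_bot (ht m hm) n
      rw [← N'.range_mkQ, ← Submodule.map_top, ← Submodule.map_smul'', Submodule.mkQ_map_self]
    have h3 : (N'.mkQ.lTensor A) x = 0 := by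
      rw [injective_iff_map_eq_zero] at h2
      apply h2
      rw [← LinearMap.comp_apply, LinearMap.rTensor_comp_lTensor, ← LinearMap.lTensor_comp_rTensor,
        LinearMap.comp_apply, hx, map_zero]
    obtain ⟨y, rfl⟩ := (hex x).mp h3
    rw [← Ideal.map_pow]
    exact range_lTensor_subtype_le _ _ y
  obtain ⟨r, hr⟩ := (Ideal.mem_iInf_smul_pow_eq_bot_iff _ x).mp h1
  have hrP : (r : A) ∈ P := Ideal.map_comap_le r.2
  have : 1 - (r : A) ∈ P := hle (by rw [Ideal.mem_torsionOf_iff, sub_smul, one_smul, hr, sub_self])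
  exact hP.ne_top ((Ideal.eq_top_iff_one _).mpr (by simpa using add_mem this hrP))

end UniversallyRegular

/-! ### Integral closedness of smooth algebras over a reduced base -/

theorem lTensor_smul {R A : Type*} [CommRing R] [CommRing A] [Algebra R A] {N M : Type*}
    [AddCommGroup N] [Module R N] [AddCommGroup M] [Module R M] (f : N →ₗ[R] M) (t : A)
    (x : A ⊗[R] N) : f.lTensor A (t • x) = t • f.lTensor A x :=
  map_smul (TensorProduct.AlgebraTensorModule.lTensor A A f) t x

theorem exists_smul_eq_of_field {R A K : Type*} [CommRing R] [CommRing A] [Algebra R A]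
    [Algebra.Smooth R A] [Field K] [Algebra R K] {p : Polynomial A} (hp : p.Monic) {t a : A}
    (ht : Function.Injective (fun x : A ⊗[R] K => t • x))
    (hpa : (p.scaleRoots t).eval a = 0) : ∃ c : A ⊗[R] K, t • c = a ⊗ₜ 1 := by
  have hcomm : ∀ (x : A) (y : A ⊗[R] K), (Algebra.TensorProduct.comm R A K) (x • y) =
      Algebra.TensorProduct.includeRight x * Algebra.TensorProduct.comm R A K y := fun x y => by
    rw [Algebra.smul_def, map_mul]; simp
  obtain ⟨c, hc⟩ : (Algebra.TensorProduct.includeRight t : K ⊗[R] A) ∣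
      Algebra.TensorProduct.includeRight a := by
    cases subsingleton_or_nontrivial (K ⊗[R] A)
    · exact ⟨0, Subsingleton.elim _ _⟩
    refine dvd_of_smooth_of_field K
      (p := p.map (Algebra.TensorProduct.includeRight : A →ₐ[R] K ⊗[R] A).toRingHom)
      (hp.map _) ?_ ?_
    · intro x y hxy
      apply (Algebra.TensorProduct.comm R A K).symm.injective
      apply ht
      apply (Algebra.TensorProduct.comm R A K).injective
      simp only [hcomm, AlgEquiv.apply_symm_apply]
      exact hxy
    · have := Polynomial.map_scaleRoots p t
        (Algebra.TensorProduct.includeRight : A →ₐ[R] K ⊗[R] A).toRingHom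
        (by rw [hp.leadingCoeff, map_one]; exact one_ne_zero)
      erw [← this]
      erw [Polynomial.eval_map, Polynomial.eval₂_at_apply, hpa, map_zero]
  refine ⟨(Algebra.TensorProduct.comm R A K).symm c, ?_⟩
  apply (Algebra.TensorProduct.comm R A K).injective
  rw [hcomm, AlgEquiv.apply_symm_apply, ← hc]
  simp

/-- The quotient `z` is integral over `A`, hence comes from some `w` in `A ⊗ R'` with `R'` the
integral closure of `R` in `T`. The class of `w` in `A ⊗ (R' / R)` is killed by `t`, since `t • w`
comes from `A`; as `t` is injective there too, `w` itself comes from `A`. -/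
theorem dvd_of_smul_eq_tmul_one {R A T : Type u} [CommRing R] [CommRing A]
    [Algebra R A] [Algebra.Smooth R A] [CommRing T] [Algebra R T]
    (hRT : Function.Injective (algebraMap R T)) {p : Polynomial A} (hp : p.Monic) {t a : A}
    (ht : ∀ (N : Type u) [AddCommGroup N] [Module R N],
      Function.Injective (fun x : A ⊗[R] N => t • x))
    (hpa : (p.scaleRoots t).eval a = 0) {z : A ⊗[R] T} (hz : t • z = a ⊗ₜ 1) : t ∣ a := by
  have hzint : IsIntegral A z := isIntegral_of_scaleRoots_eval_eq_zero hp hpa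
    (by rw [← Algebra.smul_def, hz]; rfl) fun x y hxy => ht T (by simpa only [Algebra.smul_def])
  obtain ⟨w, hw⟩ := (TensorProduct.toIntegralClosure_bijective_of_smooth (R := R) (S := A)
    (B := T)).2 ⟨z, hzint⟩
  have hw' : t • w = a ⊗ₜ 1 := by
    apply (TensorProduct.toIntegralClosure_bijective_of_smooth (R := R) (S := A) (B := T)).1
    rw [map_smul, hw]
    apply Subtype.ext
    simpa [TensorProduct.toIntegralClosure] using hz
  -- From here on only the injectivity of `R → R'` matters.
  clear hw hzint hz
  generalize integralClosure R T = R' at w hw'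
  let φ : R →ₗ[R] R' := Algebra.linearMap R R'
  have hφ : Function.Injective φ := fun x y hxy => hRT (congrArg Subtype.val hxy)
  have hex := lTensor_exact A (LinearMap.exact_map_mkQ_range φ) (Submodule.mkQ_surjective _)
  have hA := Module.Flat.lTensor_preserves_injective_linearMap (M := A) φ hφ
  have h1 : φ.lTensor A (a ⊗ₜ 1) = t • w := by
    rw [hw']; simp [φ]
  have h2 : (LinearMap.range φ).mkQ.lTensor A w = 0 := by
    apply ht
    beta_reduce
    rw [smul_zero, ← lTensor_smul, ← h1]
    exact hex.apply_apply_eq_zero _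
  obtain ⟨w', rfl⟩ := (hex w).mp h2
  have h3 : (a ⊗ₜ 1 : A ⊗[R] R) = t • w' := by
    apply hA
    rw [h1, lTensor_smul]
  refine ⟨Algebra.TensorProduct.rid R A A w', ?_⟩
  have := congrArg (Algebra.TensorProduct.rid R A A) h3
  simpa [map_smul] using this

theorem algebraMap_pi_fractionRing_injective (R : Type*) [CommRing R] [IsReduced R]
    [∀ q : minimalPrimes R, q.1.IsPrime] :
    Function.Injective (algebraMap R (∀ q : minimalPrimes R, FractionRing (R ⧸ q.1))) := by
  rw [injective_iff_map_eq_zero]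
  intro x hx
  have : x ∈ sInf (minimalPrimes R) := by
    rw [Submodule.mem_sInf]
    intro (q : Ideal R) hq
    have : q.IsPrime := hq.1.1
    have h1 : algebraMap R (FractionRing (R ⧸ q)) x = 0 := congrFun hx ⟨q, hq⟩
    rw [IsScalarTower.algebraMap_apply R (R ⧸ q)] at h1
    exact Ideal.Quotient.eq_zero_iff_mem.mp ((injective_iff_map_eq_zero _).mp
      (IsFractionRing.injective (R ⧸ q) (FractionRing (R ⧸ q))) _ h1)
  have h2 : sInf (minimalPrimes R) = nilradical R := by
    rw [minimalPrimes, Ideal.sInf_minimalPrimes]; rfl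
  rw [h2, nilradical_eq_zero] at this
  simpa using this

/-- A smooth algebra over a reduced Noetherian ring is integrally closed in its localisation at
an element that is universally regular. -/
theorem dvd_of_smooth {R A : Type u} [CommRing R] [IsNoetherianRing R] [IsReduced R] [CommRing A]
    [Algebra R A] [Algebra.Smooth R A] {p : Polynomial A} (hp : p.Monic) {t a : A}
    (ht : ∀ (N : Type u) [AddCommGroup N] [Module R N],
      Function.Injective (fun x : A ⊗[R] N => t • x))
    (hpa : (p.scaleRoots t).eval a = 0) : t ∣ a := by
  classical
  have : Fintype (minimalPrimes R) := (minimalPrimes.finite_of_isNoetherianRing R).fintype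
  have hprime : ∀ q : minimalPrimes R, q.1.IsPrime := fun q => q.2.1.1
  have hinj := algebraMap_pi_fractionRing_injective R
  have hfield : ∀ q : minimalPrimes R, ∃ c : A ⊗[R] FractionRing (R ⧸ q.1), t • c = a ⊗ₜ 1 :=
    fun q => exists_smul_eq_of_field hp (ht _) hpa
  choose c hc using hfield
  let e := TensorProduct.piRight R A A fun q : minimalPrimes R => FractionRing (R ⧸ q.1)
  refine dvd_of_smul_eq_tmul_one hinj hp ht hpa (z := e.symm c) ?_
  apply e.injective
  rw [map_smul, e.apply_symm_apply]
  ext q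
  rw [Pi.smul_apply, hc]
  simp [e]

/-! ### Algebra at the generic point of a fiber -/

theorem isRadical_map_of_smooth {R A : Type*} [CommRing R] [CommRing A] [Algebra R A]
    [Algebra.Smooth R A] (m : Ideal R) [m.IsMaximal] : (m.map (algebraMap R A)).IsRadical := by
  let := Ideal.Quotient.field m
  have : IsReduced ((R ⧸ m) ⊗[R] A) := isReduced_of_smooth_of_field (R ⧸ m) _
  rw [Ideal.isRadical_iff_quotient_reduced]
  let e := (Algebra.TensorProduct.quotIdealMapEquivTensorQuot A m).toRingEquiv.trans
      (Algebra.TensorProduct.comm R A (R ⧸ m)).toRingEquiv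
  exact isReduced_of_injective e e.injective

/-- If the fibre over a closed point is irreducible with generic point `Q` and the algebra is
smooth at `Q`, then the fibre is reduced at `Q`. -/
theorem exists_pow_mul_mem_map {R B B' : Type*} [CommRing R] [CommRing B] [Algebra R B]
    [CommRing B'] [Algebra R B'] [Algebra B B'] [IsScalarTower R B B'] [Algebra.Smooth R B']
    {m : Ideal R} [m.IsMaximal] {Q : Ideal B}
    (hQ : ∀ Q' : Ideal B, Q'.IsPrime → Q'.comap (algebraMap R B) = m → Q ≤ Q')
    (e : B) [IsLocalization.Away e B'] {c : B} (hc : c ∈ Q) :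
    ∃ n : ℕ, e ^ n * c ∈ m.map (algebraMap R B) := by
  -- The extended ideal is radical, so it is the intersection of the primes above it. By maximality
  -- of `m` these contract to primes of `B` over `m`, all of which contain `Q`.
  have h1 : algebraMap B B' c ∈ m.map (algebraMap R B') := by
    rw [← (isRadical_map_of_smooth (A := B') m).radical, Ideal.radical_eq_sInf, Submodule.mem_sInf]
    rintro (J : Ideal B') ⟨hJ, hJp : J.IsPrime⟩
    refine hQ (J.comap (algebraMap B B')) inferInstance ?_ hc
    have h2 : m ≤ (J.comap (algebraMap B B')).comap (algebraMap R B) := by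
      rw [Ideal.comap_comap, ← IsScalarTower.algebraMap_eq]
      exact Ideal.map_le_iff_le_comap.mp hJ
    exact (Ideal.IsMaximal.eq_of_le ‹_› (Ideal.comap_ne_top _ (Ideal.comap_ne_top _ hJp.ne_top))
      h2).symm
  rw [IsScalarTower.algebraMap_eq R B B', ← Ideal.map_map,
    IsLocalization.algebraMap_mem_map_algebraMap_iff (Submonoid.powers e)] at h1
  obtain ⟨_, ⟨n, rfl⟩, hn⟩ := h1
  exact ⟨n, hn⟩

/-- A form of Nakayama's lemma at a prime ideal. -/
theorem exists_notMem_smul_eq_zero {A M : Type*} [CommRing A] [AddCommGroup M] [Module A M]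
    [Module.Finite A M] {q : Ideal A} [hq : q.IsPrime]
    (h : ∀ x : M, ∃ u ∉ q, u • x ∈ (q • ⊤ : Submodule A M)) :
    ∃ t ∉ q, ∀ x : M, t • x = 0 := by
  classical
  choose u hu hux using h
  obtain ⟨s, hs⟩ := Module.Finite.fg_top (R := A) (M := M)
  let v := ∏ x ∈ s, u x
  have hv : v ∉ q := by
    intro hv
    obtain ⟨x, -, hx⟩ := (Ideal.IsPrime.prod_mem_iff).mp hv
    exact hu x hx
  have hvx : ∀ x : M, v • x ∈ (q • ⊤ : Submodule A M) := by
    intro x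
    have hx : x ∈ Submodule.span A (s : Set M) := hs ▸ Submodule.mem_top
    induction hx using Submodule.span_induction with
    | mem x hx =>
      obtain ⟨w, hw⟩ := Finset.dvd_prod_of_mem u (Finset.mem_coe.mp hx)
      rw [show v = w * u x by rw [mul_comm]; exact hw, mul_smul]
      exact Submodule.smul_mem _ _ (hux x)
    | zero => simp
    | add x y _ _ hx hy => rw [smul_add]; exact add_mem hx hy
    | smul a x _ hx => rw [smul_comm]; exact Submodule.smul_mem _ _ hx
  -- Cayley–Hamilton for multiplication by `v`: the annihilator sought is `p(v)`, congruent to a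
  -- power of `v` modulo `q` and hence outside `q`.
  obtain ⟨p, hp, -, hcoeff, hzero⟩ :=
    LinearMap.exists_monic_and_natDegree_eq_and_coeff_mem_pow_and_aeval_eq_zero A
      (algebraMap A (Module.End A M) v) q (by rintro _ ⟨x, rfl⟩; exact hvx x)
  refine ⟨p.eval v, fun hmem => hv ?_, fun x => ?_⟩
  · have h1 : p.map (Ideal.Quotient.mk q) = Polynomial.X ^ p.natDegree := by
      ext k
      rw [Polynomial.coeff_map, Polynomial.coeff_X_pow]
      split_ifs with hk
      · rw [hk, hp.coeff_natDegree, map_one]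
      · rcases lt_or_gt_of_ne hk with hk | hk
        · rw [Ideal.Quotient.eq_zero_iff_mem]
          exact Ideal.pow_le_self (by omega) (hcoeff k)
        · rw [Polynomial.coeff_eq_zero_of_natDegree_lt hk, map_zero]
    have h2 := congrArg (Polynomial.eval (Ideal.Quotient.mk q v)) h1
    rw [Polynomial.eval_map, Polynomial.eval₂_at_apply, Polynomial.eval_pow, Polynomial.eval_X,
      Ideal.Quotient.eq_zero_iff_mem.mpr hmem, ← map_pow] at h2
    exact hq.mem_of_pow_mem _ (Ideal.Quotient.eq_zero_iff_mem.mp h2.symm)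
  · rw [Polynomial.aeval_algebraMap_apply_eq_algebraMap_eval] at hzero
    exact LinearMap.congr_fun hzero x

theorem eq_of_le_of_comap_eq {A B : Type*} [CommRing A] [CommRing B] [Algebra A B]
    [Algebra.IsIntegral A B] {I J : Ideal B} [I.IsPrime] (hIJ : I ≤ J)
    (h : I.comap (algebraMap A B) = J.comap (algebraMap A B)) : I = J := by
  by_contra hne
  exact (Ideal.IsIntegral.comap_lt_comap (R := A) (lt_of_le_of_ne hIJ hne)).ne h

/-- A finite algebra `A → B` which is unramified with trivial residue field extension at a prime
with only one prime above it is surjective near that prime. -/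
theorem exists_notMem_mul_mem_range {A B : Type*} [CommRing A] [CommRing B] [Algebra A B]
    [Module.Finite A B] {Q : Ideal B} [Q.IsPrime]
    (hQ : ∀ Q' : Ideal B, Q'.IsPrime →
      Q'.comap (algebraMap A B) = Q.comap (algebraMap A B) → Q' = Q)
    (hres : ∀ b : B, ∃ a a' : A, algebraMap A B a' ∉ Q ∧
      algebraMap A B a' * b - algebraMap A B a ∈ Q)
    (hmax : ∀ c ∈ Q, ∃ v ∉ Q, v * c ∈ (Q.comap (algebraMap A B)).map (algebraMap A B)) :
    ∃ t : A, algebraMap A B t ∉ Q ∧ ∀ b : B, algebraMap A B t * b ∈ (algebraMap A B).range := by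
  set q := Q.comap (algebraMap A B) with hq
  let N : Submodule A B := LinearMap.range (Algebra.linearMap A B)
  -- The multiplier `v` lives in `B`, and one from `A` is needed. Otherwise the colon ideal `J`
  -- contracts into `q`, and going up gives a prime over `q` containing `J`; that prime must be `Q`,
  -- contradicting `v ∉ Q`.
  have key : ∀ c ∈ Q, ∃ u ∉ q, algebraMap A B u * c ∈ q.map (algebraMap A B) := by
    intro c hc
    obtain ⟨v, hv, hvc⟩ := hmax c hc
    let J : Ideal B := (q.map (algebraMap A B)).colon {c}
    have hmem : ∀ x, x ∈ J ↔ x * c ∈ q.map (algebraMap A B) := fun x => by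
      rw [Submodule.mem_colon_singleton, smul_eq_mul]
    by_contra! hcon
    have hle : J.comap (algebraMap A B) ≤ q := by
      intro x hx
      by_contra hxq
      exact hcon x hxq ((hmem _).mp hx)
    obtain ⟨Q', hJQ', hQ', hQ'q⟩ := Ideal.exists_ideal_over_prime_of_isIntegral q J hle
    rw [hQ Q' hQ' hQ'q] at hJQ'
    exact hv (hJQ' ((hmem v).mpr hvc))
  obtain ⟨t, ht, htx⟩ := exists_notMem_smul_eq_zero (M := B ⧸ N) (q := q) (by
    intro x
    obtain ⟨b, rfl⟩ := N.mkQ_surjective x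
    obtain ⟨a, a', ha', hb⟩ := hres b
    obtain ⟨u, hu, huc⟩ := key _ hb
    refine ⟨u * a', fun h => (Ideal.IsPrime.mem_or_mem (I := q) inferInstance h).elim hu ha', ?_⟩
    have h1 : (u * a') • N.mkQ b =
        N.mkQ (algebraMap A B u * (algebraMap A B a' * b - algebraMap A B a)) := by
      rw [← map_smul, ← sub_eq_zero, ← map_sub]
      simp only [Submodule.mkQ_apply, Submodule.Quotient.mk_eq_zero]
      refine ⟨u * a, ?_⟩
      simp only [Algebra.linearMap_apply, Algebra.smul_def, map_mul]
      ring
    rw [h1, ← N.range_mkQ, ← Submodule.map_top, ← Submodule.map_smul'']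
    refine Submodule.mem_map_of_mem ?_
    rw [Ideal.smul_top_eq_map]
    exact huc)
  refine ⟨t, ht, fun b => ?_⟩
  have h1 := htx (N.mkQ b)
  rw [← map_smul, Submodule.mkQ_apply, Submodule.Quotient.mk_eq_zero] at h1
  obtain ⟨a, ha⟩ := h1
  exact ⟨a, by simpa [Algebra.smul_def] using ha⟩

/-! ### Removing the denominator `t` -/

theorem isMaximal_comap_of_finiteType {R A : Type*} [CommRing R] [CommRing A] [Algebra R A]
    [IsJacobsonRing R] [Algebra.FiniteType R A] (P : Ideal A) [P.IsMaximal] :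
    (P.comap (algebraMap R A)).IsMaximal := by
  let := Ideal.Quotient.field P
  have := finite_of_finite_type_of_isJacobsonRing R (A ⧸ P)
  have h := Ideal.isMaximal_comap_of_isIntegral_of_isMaximal (R := R) (⊥ : Ideal (A ⧸ P))
  rwa [IsScalarTower.algebraMap_eq R A, ← Ideal.comap_comap,
    show (⊥ : Ideal (A ⧸ P)).comap (algebraMap A (A ⧸ P)) = P from Ideal.mk_ker] at h

theorem mem_range_of_mul_mem_range {R A B : Type u} [CommRing R] [IsNoetherianRing R] [IsReduced R]
    [IsJacobsonRing R] [CommRing A] [Algebra R A] [Algebra.Smooth R A] [CommRing B] [IsReduced B]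
    [Algebra R B] [Algebra A B] [IsScalarTower R A B] [Module.Finite A B]
    (hinj : Function.Injective (algebraMap A B)) {t : A} {b : B}
    (htb : algebraMap A B t * b ∈ (algebraMap A B).range)
    (h : ∀ m : Ideal R, m.IsMaximal → ∃ Q : Ideal B, Q.IsPrime ∧
      Q.comap (algebraMap R B) = m ∧ algebraMap A B t ∉ Q ∧
      ∀ Q' : Ideal B, Q'.IsPrime → Q'.comap (algebraMap R B) = m → Q ≤ Q') :
    b ∈ (algebraMap A B).range := by
  obtain ⟨a, ha⟩ := htb
  have hft : Algebra.FiniteType R B := .trans (S := A) inferInstance inferInstance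
  have hnoeth : IsNoetherianRing A := Algebra.FiniteType.isNoetherianRing R A
  have hjac : IsJacobsonRing B := isJacobsonRing_of_finiteType (A := R)
  -- If `t x = 0`, then `x` lies in the generic prime of every closed fiber, hence in every maximal
  -- ideal. In a reduced Jacobson ring this forces `x = 0`.
  have htreg : ∀ x : B, algebraMap A B t * x = 0 → x = 0 := by
    intro x hx
    have hx' : x ∈ (⊥ : Ideal B).jacobson := by
      rw [Ideal.jacobson, Submodule.mem_sInf]
      rintro (P : Ideal B) ⟨-, hP : P.IsMaximal⟩
      obtain ⟨Q, hQ, -, htQ, hmin⟩ := h _ (isMaximal_comap_of_finiteType (R := R) P)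
      refine hmin P hP.isPrime rfl ?_
      exact (hQ.mem_or_mem (by rw [hx]; exact Q.zero_mem)).resolve_left htQ
    rw [← Ideal.radical_eq_jacobson] at hx'
    simpa [Ideal.radical_bot_of_isReduced] using hx'
  -- The ideal `mA` is radical, and by lying over every prime containing it contains the contraction
  -- of `Q`, which `t` avoids.
  have hfib : ∀ m : Ideal R, m.IsMaximal → ∀ x : A,
      t * x ∈ m.map (algebraMap R A) → x ∈ m.map (algebraMap R A) := by
    intro m hm x hx
    obtain ⟨Q, hQ, hQm, htQ, hmin⟩ := h m hm
    have hle : m.map (algebraMap R A) ≤ Q.comap (algebraMap A B) := by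
      rw [Ideal.map_le_iff_le_comap, Ideal.comap_comap, ← IsScalarTower.algebraMap_eq, hQm]
    have hxQ : x ∈ Q.comap (algebraMap A B) :=
      (Ideal.IsPrime.mem_or_mem (I := Q.comap (algebraMap A B)) inferInstance
        (hle hx)).resolve_left htQ
    rw [← (isRadical_map_of_smooth (A := A) m).radical, Ideal.radical_eq_sInf, Submodule.mem_sInf]
    rintro (J : Ideal A) ⟨hJ, hJp : J.IsPrime⟩
    obtain ⟨Q', -, hQ', rfl⟩ := Ideal.exists_ideal_over_prime_of_isIntegral J (⊥ : Ideal B) (by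
      rw [← RingHom.ker_eq_comap_bot, (RingHom.injective_iff_ker_eq_bot _).mp hinj]
      exact bot_le)
    refine hmin Q' hQ' ?_ hxQ
    rw [IsScalarTower.algebraMap_eq R A B, ← Ideal.comap_comap]
    exact (hm.eq_of_le (Ideal.comap_ne_top _ hJp.ne_top) (Ideal.map_le_iff_le_comap.mp hJ)).symm
  obtain ⟨p, hp, hpb⟩ := Algebra.IsIntegral.isIntegral (R := A) b
  have hdvd : t ∣ a := by
    refine dvd_of_smooth (R := R) hp ?_ ?_
    · intro N _ _
      have := rTensor_mulLeft_injective (R := R) (A := A)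
        (fun P hP => isMaximal_comap_of_finiteType P) hfib N
      intro x y hxy
      apply this
      simpa only [rTensor_mulLeft_apply] using hxy
    · apply hinj
      rw [map_zero, ← Polynomial.eval₂_at_apply, ha, Polynomial.scaleRoots_eval₂_mul, hpb, mul_zero]
  obtain ⟨a', rfl⟩ := hdvd
  refine ⟨a', ?_⟩
  rw [← sub_eq_zero]
  apply htreg
  rw [mul_sub, ← ha, map_mul, sub_self]

/-! ### Points and primes on affine opens -/

section AffineOpen

variable {X : Scheme.{u}} {U : X.Opens}

theorem mem_primeIdealOf_iff (hU : IsAffineOpen U) (x : U) (b : Γ(X, U)) :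
    b ∈ (hU.primeIdealOf x).asIdeal ↔ x.1 ∉ X.basicOpen b := by
  have h : hU.primeIdealOf x ∈ hU.fromSpec ⁻¹ᵁ X.basicOpen b ↔ x.1 ∈ X.basicOpen b := by
    conv_rhs => rw [← hU.fromSpec_primeIdealOf x]
    rfl
  rw [hU.fromSpec_preimage_basicOpen] at h
  rw [← h]
  exact not_not.symm

theorem primeIdealOf_le_of_specializes (hU : IsAffineOpen U) {x y : U} (h : x.1 ⤳ y.1) :
    (hU.primeIdealOf x).asIdeal ≤ (hU.primeIdealOf y).asIdeal := by
  intro b hb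
  rw [mem_primeIdealOf_iff] at hb ⊢
  exact fun hy => hb (h.mem_open (X.basicOpen b).2 hy)

theorem exists_primeIdealOf_eq (hU : IsAffineOpen U) (P : Ideal Γ(X, U)) [hP : P.IsPrime] :
    ∃ x : U, (hU.primeIdealOf x).asIdeal = P := by
  obtain ⟨x, hx⟩ := (ConcreteCategory.bijective_of_isIso hU.isoSpec.hom.base).2 ⟨P, hP⟩
  exact ⟨x, congrArg PrimeSpectrum.asIdeal hx⟩

theorem primeIdealOf_injective (hU : IsAffineOpen U) : Function.Injective hU.primeIdealOf :=
  (ConcreteCategory.bijective_of_isIso hU.isoSpec.hom.base).1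

theorem isClosed_singleton_of_isMaximal_primeIdealOf [JacobsonSpace X] (hU : IsAffineOpen U) (x : U)
    (hx : (hU.primeIdealOf x).asIdeal.IsMaximal) : IsClosed ({x.1} : Set X) := by
  have h1 : IsClosed ({hU.primeIdealOf x} : Set (Spec Γ(X, U))) :=
    (PrimeSpectrum.isClosed_singleton_iff_isMaximal _).mpr hx
  have h2 : x.1 ∈ closedPoints X := by
    rw [← hU.fromSpec_primeIdealOf x]
    have := (Topology.IsOpenEmbedding.preimage_closedPoints hU.fromSpec.isOpenEmbedding).ge h1
    exact this
  exact h2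

theorem exists_mul_evaluation_eq (hU : IsAffineOpen U) (x : U) (z : X.residueField x.1) :
    ∃ a a' : Γ(X, U), x.1 ∈ X.basicOpen a' ∧
      X.evaluation U x.1 x.2 a' * z = X.evaluation U x.1 x.2 a := by
  obtain ⟨σ, rfl⟩ := X.residue_surjective x.1 z
  let := X.presheaf.algebra_section_stalk x
  have := hU.isLocalization_stalk x
  obtain ⟨⟨a, s⟩, h⟩ := IsLocalization.surj (hU.primeIdealOf x).asIdeal.primeCompl σ
  refine ⟨a, s, by_contra fun h1 => s.2 ((mem_primeIdealOf_iff hU x _).mpr h1), ?_⟩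
  have h2 := congrArg (X.residue x.1) h
  rw [map_mul, mul_comm] at h2
  exact h2

end AffineOpen

theorem primeIdealOf_comap_appLE {X Y : Scheme.{u}} (f : X ⟶ Y) {V : Y.Opens} (hV : IsAffineOpen V)
    {U : X.Opens} (hU : IsAffineOpen U) (e : U ≤ f ⁻¹ᵁ V) (x : U) :
    (hU.primeIdealOf x).asIdeal.comap (f.appLE V U e).hom =
      (hV.primeIdealOf ⟨f x.1, e x.2⟩).asIdeal := by
  rw [← IsAffineOpen.comap_primeIdealOf_appLE V hV U hU e x.2]
  rfl

theorem app_injective_of_surjective {X Y : Scheme.{u}} (f : X ⟶ Y) [Surjective f] [IsReduced Y]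
    (W : Y.Opens) : Function.Injective (f.app W).hom := by
  rw [injective_iff_map_eq_zero]
  intro a ha
  rw [← basicOpen_eq_bot_iff]
  ext y
  simp only [TopologicalSpace.Opens.coe_bot, Set.mem_empty_iff_false, iff_false]
  intro hy
  obtain ⟨x, rfl⟩ := f.surjective y
  have : x ∈ f ⁻¹ᵁ Y.basicOpen a := hy
  rw [Scheme.Hom.preimage_basicOpen] at this
  erw [ha, Scheme.basicOpen_zero] at this
  exact this

/-! ### Residue fields and generic points of fibers -/

section ResidueField

theorem residueFieldMap_comp_surjective_iff {X Y Z : Scheme.{u}} (f : X ⟶ Y) (g : Y ⟶ Z) (x : X)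
    (hf : Function.Surjective (f.residueFieldMap x)) :
    Function.Surjective ((f ≫ g).residueFieldMap x) ↔
      Function.Surjective (g.residueFieldMap (f x)) := by
  rw [Scheme.residueFieldMap_comp]
  constructor
  · intro h z
    obtain ⟨w, hw⟩ := h (f.residueFieldMap x z)
    refine ⟨w, ?_⟩
    apply (f.residueFieldMap x).hom.injective
    exact hw
  · intro h
    exact hf.comp h

theorem residueFieldMap_surjective_of_surjective_stalkMap {X Y : Scheme.{u}} (f : X ⟶ Y) (x : X)
    (h : Function.Surjective (f.stalkMap x)) : Function.Surjective (f.residueFieldMap x) := by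
  intro z
  obtain ⟨σ, rfl⟩ := X.residue_surjective x z
  obtain ⟨τ, rfl⟩ := h σ
  refine ⟨Y.residue _ τ, ?_⟩
  have := Scheme.residue_residueFieldMap f x
  exact congr($this τ)

theorem residueFieldMap_surjective_of_isPreimmersion {X Y : Scheme.{u}} (f : X ⟶ Y)
    [IsPreimmersion f] (x : X) : Function.Surjective (f.residueFieldMap x) :=
  residueFieldMap_surjective_of_surjective_stalkMap f x (f.stalkMap_surjective x)

/-- The inclusion of a fiber. -/
noncomputable def fiberι {X S : Scheme.{u}} (g : X ⟶ S) (s : S) (hs : IsClosed ({s} : Set S)) :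
    fiber g s hs ⟶ X :=
  (Scheme.IdealSheafData.vanishingIdeal (fiberClosed g s hs)).subschemeι

instance {X S : Scheme.{u}} (g : X ⟶ S) (s : S) (hs : IsClosed ({s} : Set S)) :
    IsPreimmersion (fiberι g s hs) :=
  inferInstanceAs (IsPreimmersion (Scheme.IdealSheafData.subschemeι _))

theorem range_fiberι {X S : Scheme.{u}} (g : X ⟶ S) (s : S) (hs : IsClosed ({s} : Set S)) :
    Set.range (fiberι g s hs) = g ⁻¹' {s} := by
  refine (Scheme.IdealSheafData.range_subschemeι _).trans ?_
  rw [Scheme.IdealSheafData.coe_support_vanishingIdeal]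
  rfl

theorem fiberMap_fiberι {X Y S : Scheme.{u}} (f : X ⟶ Y) (g : X ⟶ S)
    (h : Y ⟶ S) (w : f ≫ h = g) (s : S) (hs : IsClosed ({s} : Set S)) :
    fiberMap f g h w s hs ≫ fiberι h s hs = fiberι g s hs ≫ f :=
  Scheme.IdealSheafData.subschemeMap_subschemeι _ _ f _

/-- The generic point lies in the dense open source of the partial isomorphism. There `f` composed
with a preimmersion is again a preimmersion, and preimmersions are surjective on residue fields. -/
theorem residueFieldMap_surjective_of_isBirational {X Y S : Scheme.{u}} (f : X ⟶ Y) (g : X ⟶ S)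
    (h : Y ⟶ S) (w : f ≫ h = g) (s : S) (hs : IsClosed ({s} : Set S))
    (hbir : IsBirational (fiberMap f g h w s hs)) {ξ : X} (hξ : g ξ = s)
    (hgen : ∀ x, g x = s → ξ ⤳ x) : Function.Surjective (f.residueFieldMap ξ) := by
  obtain ⟨p, hp⟩ := hbir
  have hrange := range_fiberι g s hs
  obtain ⟨ξ', rfl⟩ : ξ ∈ Set.range (fiberι g s hs) := hrange.ge hξ
  have hξ' : ξ' ∈ p.source := by
    have : Nonempty (fiber g s hs) := ⟨ξ'⟩
    obtain ⟨a, ha⟩ := p.dense_source.nonempty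
    refine Specializes.mem_open ?_ p.source.2 ha
    rw [← (fiberι g s hs).isEmbedding.isInducing.specializes_iff]
    exact hgen _ (hrange.le ⟨a, rfl⟩)
  have hcomp : (p.iso.hom ≫ p.target.ι) ≫ fiberι h s hs = (p.source.ι ≫ fiberι g s hs) ≫ f := by
    rw [hp, Category.assoc, Category.assoc, fiberMap_fiberι]
  have h1 : Function.Surjective
      (((p.source.ι ≫ fiberι g s hs) ≫ f).residueFieldMap ⟨ξ', hξ'⟩) := by
    rw [← hcomp]
    exact residueFieldMap_surjective_of_isPreimmersion _ _
  exact (residueFieldMap_comp_surjective_iff (p.source.ι ≫ fiberι g s hs) f ⟨ξ', hξ'⟩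
    (residueFieldMap_surjective_of_isPreimmersion _ _)).mp h1

end ResidueField

theorem exists_generic_point_of_fiber {X Y S : Scheme.{u}} (f : X ⟶ Y) (g : X ⟶ S)
    (h : Y ⟶ S) (w : f ≫ h = g) (s : S) (hs : IsClosed ({s} : Set S))
    (hbir : IsBirational (fiberMap f g h w s hs)) (hirr : IsIrreducible (g ⁻¹' {s}))
    (hsm : ∃ x : X, g x = s ∧ SmoothAt g x) :
    ∃ ξ : X, g ξ = s ∧ (∀ x, g x = s → ξ ⤳ x) ∧ SmoothAt g ξ ∧
      Function.Surjective (f.residueFieldMap ξ) := by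
  have hcl : IsClosed (g ⁻¹' {s}) := hs.preimage g.continuous
  have hgp := hirr.isGenericPoint_genericPoint hcl
  have hgen : ∀ x, g x = s → hirr.genericPoint ⤳ x := fun x hx => hgp.specializes hx
  have hξ : g hirr.genericPoint = s := hgp.mem
  obtain ⟨x, hx, U, hxU, hU⟩ := hsm
  exact ⟨_, hξ, hgen, ⟨U, (hgen x hx).mem_open U.2 hxU, hU⟩,
    residueFieldMap_surjective_of_isBirational f g h w s hs hbir hξ hgen⟩

/-! ### Passage from algebra to schemes -/

theorem smooth_appLE_of_smooth_ι_comp {X S : Scheme.{u}} (g : X ⟶ S) {V : S.Opens}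
    (hV : IsAffineOpen V) {D : X.Opens} (hD : IsAffineOpen D) [Smooth (D.ι ≫ g)]
    (e : D.ι ''ᵁ ⊤ ≤ g ⁻¹ᵁ V) : (g.appLE V (D.ι ''ᵁ ⊤) e).hom.Smooth := by
  have : IsAffine D := hD
  have h := (D.ι ≫ g).smooth_appLE hV (isAffineOpen_top D.toScheme)
    (fun x _ => e ⟨x, trivial, rfl⟩)
  have h2 : (D.ι ≫ g).appLE V ⊤ (fun x _ => e ⟨x, trivial, rfl⟩) =
      g.appLE V (D.ι ''ᵁ ⊤) e :=
    (Scheme.Hom.comp_appLE D.ι g V ⊤ (fun x _ => e ⟨x, trivial, rfl⟩)).trans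
      (congrArg (g.app V ≫ ·) (Scheme.Opens.ι_appLE D _ _ _))
  exact congrArg (fun φ => φ.hom.Smooth) h2 ▸ h

/-- A finite morphism is an isomorphism near the generic point of a fiber of `h` if the fiber of
`g` is irreducible, generically smooth and has the same residue field at its generic point. -/
theorem exists_app_mul_mem_range {X Y S : Scheme.{u}} (f : X ⟶ Y) (g : X ⟶ S)
    (h : Y ⟶ S) (w : f ≫ h = g) [IsFinite f] {V : S.Opens} (hV : IsAffineOpen V)
    {W : Y.Opens} (hW : IsAffineOpen W) (e : W ≤ h ⁻¹ᵁ V) {ξ : X} (hξ : f ξ ∈ W)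
    (hs : IsClosed ({g ξ} : Set S)) (hgen : ∀ x, g x = g ξ → ξ ⤳ x) (hsm : SmoothAt g ξ)
    (hres : Function.Surjective (f.residueFieldMap ξ)) :
    ∃ t : Γ(Y, W), f ξ ∈ Y.basicOpen t ∧ ∀ b, f.app W t * b ∈ (f.app W).hom.range := by
  subst w
  have hU : IsAffineOpen (f ⁻¹ᵁ W) := hW.preimage f
  let ξ' : f ⁻¹ᵁ W := ⟨ξ, hξ⟩
  let Q := (hU.primeIdealOf ξ').asIdeal
  have hVξ : (f ≫ h) ξ ∈ V := e hξ
  let m := (hV.primeIdealOf ⟨(f ≫ h) ξ, hVξ⟩).asIdeal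
  have hm : m.IsMaximal := hV.primeIdealOf_isMaximal_of_isClosed ⟨_, hVξ⟩ hs
  have eg : f ⁻¹ᵁ W ≤ (f ≫ h) ⁻¹ᵁ V := fun x hx => e hx
  let := (f.app W).hom.toAlgebra
  let := (h.appLE V W e).hom.toAlgebra
  let := ((f ≫ h).appLE V (f ⁻¹ᵁ W) eg).hom.toAlgebra
  have htower : IsScalarTower Γ(S, V) Γ(Y, W) Γ(X, f ⁻¹ᵁ W) := IsScalarTower.of_algebraMap_eq' (by
    simp only [RingHom.algebraMap_toAlgebra, ← CommRingCat.hom_comp]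
    rw [Scheme.Hom.app_eq_appLE, Scheme.Hom.appLE_comp_appLE])
  have hfin : Module.Finite Γ(Y, W) Γ(X, f ⁻¹ᵁ W) := f.finite_app W hW
  have hmin : ∀ Q' : Ideal Γ(X, f ⁻¹ᵁ W), Q'.IsPrime →
      Q'.comap (algebraMap Γ(S, V) Γ(X, f ⁻¹ᵁ W)) = m → Q ≤ Q' := by
    intro Q' hQ' hQ'm
    obtain ⟨x, rfl⟩ := exists_primeIdealOf_eq hU Q'
    apply primeIdealOf_le_of_specializes hU
    apply hgen
    have h1 := primeIdealOf_comap_appLE (f ≫ h) hV hU eg x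
    have h2 := primeIdealOf_injective hV (PrimeSpectrum.ext (h1.symm.trans hQ'm))
    exact congrArg Subtype.val h2
  have hQm : Q.comap (algebraMap Γ(S, V) Γ(X, f ⁻¹ᵁ W)) = m :=
    primeIdealOf_comap_appLE (f ≫ h) hV hU eg ξ'
  have hmA : m.map (algebraMap Γ(S, V) Γ(X, f ⁻¹ᵁ W)) ≤
      (Q.comap (algebraMap Γ(Y, W) Γ(X, f ⁻¹ᵁ W))).map (algebraMap Γ(Y, W) Γ(X, f ⁻¹ᵁ W)) := by
    rw [IsScalarTower.algebraMap_eq Γ(S, V) Γ(Y, W) Γ(X, f ⁻¹ᵁ W), ← Ideal.map_map]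
    apply Ideal.map_mono
    rw [Ideal.map_le_iff_le_comap, Ideal.comap_comap, ← IsScalarTower.algebraMap_eq, hQm]
  suffices H : ∃ t : Γ(Y, W), algebraMap Γ(Y, W) Γ(X, f ⁻¹ᵁ W) t ∉ Q ∧
      ∀ b, algebraMap Γ(Y, W) Γ(X, f ⁻¹ᵁ W) t * b ∈ (algebraMap Γ(Y, W) Γ(X, f ⁻¹ᵁ W)).range by
    obtain ⟨t, htQ, ht⟩ := H
    refine ⟨t, ?_, ht⟩
    have h1 := (mem_primeIdealOf_iff hU ξ' _).not_left.mp htQ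
    have h2 : (algebraMap Γ(Y, W) Γ(X, f ⁻¹ᵁ W)) t = f.app W t := rfl
    rw [h2, ← Scheme.Hom.preimage_basicOpen] at h1
    exact h1
  refine exists_notMem_mul_mem_range (Q := Q) ?_ ?_ ?_
  · intro Q' hQ' hcomap
    -- A prime with the same contraction to `Y` lies in the same fiber over `S`, so it contains `Q`;
    -- incomparability gives equality.
    refine (eq_of_le_of_comap_eq (A := Γ(Y, W)) (hmin Q' hQ' ?_) hcomap.symm).symm
    rw [IsScalarTower.algebraMap_eq Γ(S, V) Γ(Y, W) Γ(X, f ⁻¹ᵁ W), ← Ideal.comap_comap, hcomap,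
      Ideal.comap_comap, ← IsScalarTower.algebraMap_eq, hQm]
  · intro b
    obtain ⟨z, hz⟩ := hres (X.evaluation (f ⁻¹ᵁ W) ξ hξ b)
    obtain ⟨a, a', ha', haz⟩ := exists_mul_evaluation_eq hW ⟨f ξ, hξ⟩ z
    refine ⟨a, a', ?_, ?_⟩
    · refine (mem_primeIdealOf_iff hU ξ' _).not_left.mpr ?_
      have h2 : (algebraMap Γ(Y, W) Γ(X, f ⁻¹ᵁ W)) a' = f.app W a' := rfl
      rw [h2, ← Scheme.Hom.preimage_basicOpen]
      exact ha'
    · refine (mem_primeIdealOf_iff hU ξ' _).mpr ?_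
      rw [← Scheme.evaluation_eq_zero_iff_notMem_basicOpen X ξ hξ, map_sub, map_mul, sub_eq_zero]
      have h1 := congrArg (f.residueFieldMap ξ) haz
      rw [map_mul, Scheme.evaluation_naturality_apply, Scheme.evaluation_naturality_apply,
        hz] at h1
      exact h1
  · obtain ⟨U, hξU, hUsm⟩ := hsm
    obtain ⟨r, hrU, hξr⟩ := hU.exists_basicOpen_le (V := U) ⟨ξ, hξU⟩ hξ
    let D := X.basicOpen r
    have hD : IsAffineOpen D := hU.basicOpen r
    have hDsm : Smooth (D.ι ≫ f ≫ h) := by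
      rw [← X.homOfLE_ι hrU, Category.assoc]
      infer_instance
    have hDD : D.ι ''ᵁ ⊤ = X.basicOpen r := by simp [D]
    have hDle : D.ι ''ᵁ ⊤ ≤ f ⁻¹ᵁ W := hDD.trans_le (X.basicOpen_le r)
    let B' := Γ(X, D.ι ''ᵁ ⊤)
    let := ((f ≫ h).appLE V (D.ι ''ᵁ ⊤) (hDle.trans eg)).hom.toAlgebra
    let := (X.presheaf.map (homOfLE hDle).op).hom.toAlgebra
    have hloc : IsLocalization.Away r B' :=
      hU.isLocalization_of_eq_basicOpen r (homOfLE hDle) hDD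
    have hsmooth : Algebra.Smooth Γ(S, V) B' :=
      smooth_appLE_of_smooth_ι_comp (f ≫ h) hV hD (hDle.trans eg)
    have : IsScalarTower Γ(S, V) Γ(X, f ⁻¹ᵁ W) B' := IsScalarTower.of_algebraMap_eq' (by
      simp only [RingHom.algebraMap_toAlgebra, ← CommRingCat.hom_comp]
      rw [Scheme.Hom.appLE_map])
    intro c hc
    obtain ⟨n, hn⟩ := exists_pow_mul_mem_map (B' := B') hmin r hc
    refine ⟨r ^ n, fun hr => ?_, hmA hn⟩
    exact (mem_primeIdealOf_iff hU ξ' _).mp (Ideal.IsPrime.mem_of_pow_mem inferInstance _ hr) hξr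

theorem isLocalization_preimage_basicOpen {X Y : Scheme.{u}} (f : X ⟶ Y) [IsAffineHom f]
    {W : Y.Opens} (hW : IsAffineOpen W) (r : Γ(Y, W)) :
    @IsLocalization.Away _ _ (f.app W r) Γ(X, f ⁻¹ᵁ (Y.basicOpen r)) _
      (X.presheaf.map (homOfLE (f.preimage_mono (Y.basicOpen_le r))).op).hom.toAlgebra :=
  (hW.preimage f).isLocalization_of_eq_basicOpen _ _ (Scheme.Hom.preimage_basicOpen f r)

/-- If a section becomes the image of a section of `Y` on a basic open, then so does its product
with a power of the function defining the basic open. -/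
theorem exists_pow_mul_mem_range_of_res {X Y : Scheme.{u}} (f : X ⟶ Y) [IsAffineHom f]
    {W : Y.Opens} (hW : IsAffineOpen W) (r : Γ(Y, W)) (b : Γ(X, f ⁻¹ᵁ W))
    (hb : X.presheaf.map (homOfLE (f.preimage_mono (Y.basicOpen_le r))).op b ∈
      (f.app (Y.basicOpen r)).hom.range) :
    ∃ n : ℕ, f.app W (r ^ n) * b ∈ (f.app W).hom.range := by
  obtain ⟨a', ha'⟩ := hb
  have hY := hW.isLocalization_basicOpen r
  let := (X.presheaf.map (homOfLE (f.preimage_mono (Y.basicOpen_le r))).op).hom.toAlgebra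
  have hX : IsLocalization.Away (f.app W r) Γ(X, f ⁻¹ᵁ (Y.basicOpen r)) :=
    isLocalization_preimage_basicOpen f hW r
  have hnat : ∀ a : Γ(Y, W), f.app (Y.basicOpen r) (algebraMap _ Γ(Y, Y.basicOpen r) a) =
      algebraMap _ Γ(X, f ⁻¹ᵁ (Y.basicOpen r)) (f.app W a) := fun a =>
    congr($(f.naturality (homOfLE (Y.basicOpen_le r)).op) a)
  obtain ⟨⟨a, ⟨_, n, rfl⟩⟩, ha⟩ := IsLocalization.surj (Submonoid.powers r) a'
  have h1 : algebraMap _ Γ(X, f ⁻¹ᵁ (Y.basicOpen r)) (f.app W (r ^ n) * b) =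
      algebraMap _ Γ(X, f ⁻¹ᵁ (Y.basicOpen r)) (f.app W a) := by
    rw [map_mul, ← hnat, ← hnat, ← ha, map_mul, mul_comm]
    congr 1
    exact ha'.symm
  obtain ⟨⟨_, k, rfl⟩, hk⟩ :=
    (IsLocalization.eq_iff_exists (Submonoid.powers (f.app W r)) _).mp h1
  refine ⟨k + n, r ^ k * a, ?_⟩
  change f.app W (r ^ k * a) = _
  simp only at hk
  rw [pow_add, map_mul, map_mul, mul_assoc, map_pow, hk]

/-- Every nonempty fiber of `g` over a closed point has a generic point, at which `g` is smooth and
`f` is bijective on residue fields. -/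
def HasGenericPoints {X Y S : Scheme.{u}} (f : X ⟶ Y) (g : X ⟶ S) (h : Y ⟶ S) : Prop :=
  ∀ s : S, IsClosed ({s} : Set S) → s ∈ Set.range h →
    ∃ ξ : X, g ξ = s ∧ (∀ x, g x = s → ξ ⤳ x) ∧ SmoothAt g ξ ∧
      Function.Surjective (f.residueFieldMap ξ)

/-- The locus `t ≠ 0` meets each closed fiber over `V`, and being open it then contains the image of
that fiber's generic point. -/
theorem mem_range_app_of_mul_mem_range {X Y S : Scheme.{u}} (f : X ⟶ Y) (g : X ⟶ S)
    (h : Y ⟶ S) (w : f ≫ h = g) [IsFinite f] [Surjective f] [Smooth h] [IsReduced X] [IsReduced Y]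
    [IsReduced S] [IsLocallyNoetherian S] [JacobsonSpace S] (hgp : HasGenericPoints f g h)
    {V : S.Opens} (hV : IsAffineOpen V) {W : Y.Opens} (hW : IsAffineOpen W) (e : W ≤ h ⁻¹ᵁ V)
    {t : Γ(Y, W)} (ht : ∀ s ∈ V, ∃ y ∈ Y.basicOpen t, h y = s) {b : Γ(X, f ⁻¹ᵁ W)}
    (htb : f.app W t * b ∈ (f.app W).hom.range) : b ∈ (f.app W).hom.range := by
  subst w
  have hU : IsAffineOpen (f ⁻¹ᵁ W) := hW.preimage f
  have eg : f ⁻¹ᵁ W ≤ (f ≫ h) ⁻¹ᵁ V := fun x hx => e hx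
  let := (f.app W).hom.toAlgebra
  let := (h.appLE V W e).hom.toAlgebra
  let := ((f ≫ h).appLE V (f ⁻¹ᵁ W) eg).hom.toAlgebra
  have htower : IsScalarTower Γ(S, V) Γ(Y, W) Γ(X, f ⁻¹ᵁ W) := IsScalarTower.of_algebraMap_eq' (by
    simp only [RingHom.algebraMap_toAlgebra, ← CommRingCat.hom_comp]
    rw [Scheme.Hom.app_eq_appLE, Scheme.Hom.appLE_comp_appLE])
  have hfin : Module.Finite Γ(Y, W) Γ(X, f ⁻¹ᵁ W) := f.finite_app W hW
  have hsm : Algebra.Smooth Γ(S, V) Γ(Y, W) := h.smooth_appLE hV hW e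
  have hnoeth : IsNoetherianRing Γ(S, V) := IsLocallyNoetherian.component_noetherian ⟨V, hV⟩
  have hjac : IsJacobsonRing Γ(S, V) := by
    have := JacobsonSpace.of_isOpenEmbedding hV.fromSpec.isOpenEmbedding
    exact PrimeSpectrum.isJacobsonRing_iff_jacobsonSpace.mpr this
  refine mem_range_of_mul_mem_range (R := Γ(S, V)) (app_injective_of_surjective f W) htb ?_
  intro m hm
  obtain ⟨s, rfl⟩ := exists_primeIdealOf_eq hV m
  have hs := isClosed_singleton_of_isMaximal_primeIdealOf hV s hm
  obtain ⟨y, hyt, hys⟩ := ht s s.2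
  obtain ⟨ξ, hξ, hgen, -, -⟩ := hgp s hs ⟨y, hys⟩
  obtain ⟨x, rfl⟩ := f.surjective y
  have hξt : f ξ ∈ Y.basicOpen t := ((hgen x hys).map f.continuous).mem_open (Y.basicOpen t).2 hyt
  have hξW : f ξ ∈ W := Y.basicOpen_le t hξt
  let ξ' : f ⁻¹ᵁ W := ⟨ξ, hξW⟩
  refine ⟨(hU.primeIdealOf ξ').asIdeal, inferInstance, ?_, ?_, ?_⟩
  · refine (primeIdealOf_comap_appLE (f ≫ h) hV hU eg ξ').trans ?_
    congr 2
    exact Subtype.ext hξ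
  · refine (mem_primeIdealOf_iff hU ξ' _).not_left.mpr ?_
    have h2 : (algebraMap Γ(Y, W) Γ(X, f ⁻¹ᵁ W)) t = f.app W t := rfl
    rw [h2, ← Scheme.Hom.preimage_basicOpen]
    exact hξt
  · intro Q' hQ' hQ'm
    obtain ⟨x, rfl⟩ := exists_primeIdealOf_eq hU Q'
    apply primeIdealOf_le_of_specializes hU
    apply hgen
    have h1 := primeIdealOf_comap_appLE (f ≫ h) hV hU eg x
    have h2 := primeIdealOf_injective hV (PrimeSpectrum.ext (h1.symm.trans hQ'm))
    exact congrArg Subtype.val h2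

/-- The function `t` found at the generic point may vanish at `y`. It is traded for the pullback of
a function `r` on the base, nonzero at `h y`, whose basic open lies in the open image of `t ≠ 0`;
over that basic open `t` can be divided out. -/
theorem exists_pow_mul_mem_range {X Y S : Scheme.{u}} (f : X ⟶ Y) (g : X ⟶ S)
    (h : Y ⟶ S) (w : f ≫ h = g) [IsFinite f] [Surjective f] [Smooth h] [IsReduced X] [IsReduced Y]
    [IsReduced S] [IsLocallyNoetherian S] [JacobsonSpace S] (hgp : HasGenericPoints f g h)
    {V : S.Opens} (hV : IsAffineOpen V) {W : Y.Opens} (hW : IsAffineOpen W) (e : W ≤ h ⁻¹ᵁ V)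
    (b : Γ(X, f ⁻¹ᵁ W)) {y : Y} (hyW : y ∈ W) (hy : IsClosed ({y} : Set Y)) :
    ∃ r : Γ(Y, W), y ∈ Y.basicOpen r ∧ ∃ n : ℕ, f.app W (r ^ n) * b ∈ (f.app W).hom.range := by
  have hs : IsClosed ({h y} : Set S) := h.closePoints_subset_preimage_closedPoints hy
  obtain ⟨ξ, hξ, hgen, hsm, hres⟩ := hgp _ hs ⟨y, rfl⟩
  have hξW : f ξ ∈ W := by
    obtain ⟨x, rfl⟩ := f.surjective y
    exact ((hgen x (by rw [← w]; rfl)).map f.continuous).mem_open W.2 hyW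
  obtain ⟨t, hξt, ht⟩ := exists_app_mul_mem_range f g h w hV hW e hξW (by rwa [hξ])
    (fun x hx => hgen x (hx.trans hξ)) hsm hres
  have hhξ : h (f ξ) = h y := by rw [← hξ, ← w]; rfl
  let T : S.Opens := ⟨h '' (Y.basicOpen t), h.isOpenMap _ (Y.basicOpen t).2⟩
  obtain ⟨r, hrT, hyr⟩ := hV.exists_basicOpen_le (V := T) ⟨h y, ⟨f ξ, hξt, hhξ⟩⟩ (e hyW)
  let r' : Γ(Y, W) := h.appLE V W e r
  have hbo : Y.basicOpen r' = W ⊓ h ⁻¹ᵁ S.basicOpen r := Scheme.basicOpen_appLE h W V e r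
  refine ⟨r', hbo.ge ⟨hyW, hyr⟩, exists_pow_mul_mem_range_of_res f hW r' b ?_⟩
  refine mem_range_app_of_mul_mem_range f g h w hgp (hV.basicOpen r) (hW.basicOpen r')
    (hbo.trans_le inf_le_right)
    (t := Y.presheaf.map (homOfLE (Y.basicOpen_le r')).op t) ?_ ?_
  · intro s hs
    obtain ⟨y', hy', rfl⟩ := hrT hs
    refine ⟨y', ?_, rfl⟩
    rw [Scheme.basicOpen_res]
    exact ⟨hbo.ge ⟨Y.basicOpen_le t hy', hs⟩, hy'⟩
  · obtain ⟨a, ha⟩ := ht b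
    refine ⟨Y.presheaf.map (homOfLE (Y.basicOpen_le r')).op a, ?_⟩
    have hnat : ∀ a : Γ(Y, W), f.app (Y.basicOpen r')
        (Y.presheaf.map (homOfLE (Y.basicOpen_le r')).op a) =
        X.presheaf.map (homOfLE (f.preimage_mono (Y.basicOpen_le r'))).op (f.app W a) := fun a =>
      congr($(f.naturality (homOfLE (Y.basicOpen_le r')).op) a)
    refine (hnat a).trans ?_
    rw [hnat t]
    exact (congrArg (X.presheaf.map _) ha).trans (map_mul _ _ _)

theorem isIso_of_hasGenericPoints {X Y S : Scheme.{u}} (f : X ⟶ Y) (g : X ⟶ S)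
    (h : Y ⟶ S) (w : f ≫ h = g) [IsFinite f] [Surjective f] [Smooth h] [IsReduced X] [IsReduced Y]
    [IsReduced S] [IsLocallyNoetherian S] [JacobsonSpace S] (hgp : HasGenericPoints f g h) :
    IsIso f := by
  have hJ : JacobsonSpace Y := LocallyOfFiniteType.jacobsonSpace h
  have hiso : ∀ (V : S.Opens) (_ : IsAffineOpen V) (W : Y.Opens) (_ : IsAffineOpen W)
      (_ : W ≤ h ⁻¹ᵁ V), IsIso (f.app W) := by
    intro V hV W hW e
    rw [ConcreteCategory.isIso_iff_bijective]
    refine ⟨app_injective_of_surjective f W, fun b => ?_⟩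
    let := (f.app W).hom.toAlgebra
    -- The ideal of denominators of `b`. A maximal ideal containing it would be a closed point of
    -- `Y`, as `Y` is Jacobson, and the previous lemma supplies a denominator not vanishing there.
    let I : Ideal Γ(Y, W) := (LinearMap.range (Algebra.linearMap Γ(Y, W) Γ(X, f ⁻¹ᵁ W))).colon {b}
    have hI : ∀ a, a ∈ I ↔ f.app W a * b ∈ (f.app W).hom.range := fun a => by
      rw [Submodule.mem_colon_singleton, Algebra.smul_def]
      rfl
    suffices hone : I = ⊤ by
      have := (hI 1).mp (hone ▸ Submodule.mem_top)
      rw [map_one, one_mul] at this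
      exact this
    by_contra hne
    obtain ⟨P, hP, hle⟩ := Ideal.exists_le_maximal _ hne
    obtain ⟨y, rfl⟩ := exists_primeIdealOf_eq hW P
    obtain ⟨r, hyr, n, hn⟩ := exists_pow_mul_mem_range f g h w hgp hV hW e b y.2
      (isClosed_singleton_of_isMaximal_primeIdealOf hW y hP)
    exact (mem_primeIdealOf_iff hW y r).mp (hP.isPrime.mem_of_pow_mem n (hle ((hI _).mpr hn))) hyr
  have hcover : ∀ y : Y, ∃ W : Y.Opens, y ∈ W ∧ IsIso (f ∣_ W) := by
    intro y
    obtain ⟨_, ⟨V, hV, rfl⟩, hyV, -⟩ :=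
      S.isBasis_affineOpens.exists_subset_of_mem_open (Set.mem_univ (h y)) isOpen_univ
    obtain ⟨_, ⟨W, hW, rfl⟩, hyW, hWV⟩ :=
      Y.isBasis_affineOpens.exists_subset_of_mem_open hyV (V.2.preimage h.continuous)
    exact ⟨W, hyW, (isIso_morphismRestrict_iff_isIso_app f hW).mpr (hiso V hV W hW hWV)⟩
  choose W hyW hWiso using hcover
  have htop : ⨆ y, W y = ⊤ := top_le_iff.mp fun y _ =>
    TopologicalSpace.Opens.mem_iSup.mpr ⟨y, hyW y⟩
  exact (IsZariskiLocalAtTarget.iff_of_iSup_eq_top (P := MorphismProperty.isomorphisms Scheme)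
    W htop).mpr hWiso

end FiberwiseBirational

theorem theorem1 {k : Type u} [Field k] [IsAlgClosed k] {X Y S : Scheme.{u}}
    (pX : X ⟶ Spec (.of k)) (pY : Y ⟶ Spec (.of k)) (pS : S ⟶ Spec (.of k))
    (hX : FiberwiseBirational.IsVariety pX) (hY : FiberwiseBirational.IsVariety pY)
    (hS : FiberwiseBirational.IsVariety pS)
    (f : X ⟶ Y) (g : X ⟶ S) (h : Y ⟶ S)
    (hfk : f ≫ pY = pX) (hgk : g ≫ pS = pX) (hhk : h ≫ pS = pY) (w : f ≫ h = g)
    (d : ℕ) (hd : 1 ≤ d)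
    (h_smooth : SmoothOfRelativeDimension d h)
    (f_finite : IsFinite f) (f_surj : Surjective f)
    (g_fiber : ∀ s : S, IsClosed ({s} : Set S) → s ∈ Set.range h →
      IsIrreducible (g ⁻¹' {s}) ∧
        ∃ x : X, IsClosed ({x} : Set X) ∧ g x = s ∧ FiberwiseBirational.SmoothAt g x)
    (f_birational : ∀ (s : S) (hs : IsClosed ({s} : Set S)), s ∈ Set.range h →
      FiberwiseBirational.IsBirational (FiberwiseBirational.fiberMap f g h w s hs)) :
    IsIso f := by
  have := hX.isReduced
  have := hY.isReduced
  have := hS.isReduced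
  have := hS.locallyOfFiniteType
  have : Smooth h := SmoothOfRelativeDimension.smooth d h
  have : IsLocallyNoetherian S := LocallyOfFiniteType.isLocallyNoetherian pS
  have : JacobsonSpace S := LocallyOfFiniteType.jacobsonSpace pS
  refine FiberwiseBirational.isIso_of_hasGenericPoints f g h w fun s hs hsh => ?_
  obtain ⟨hirr, x, -, hx, hsm⟩ := g_fiber s hs hsh
  exact FiberwiseBirational.exists_generic_point_of_fiber f g h w s hs (f_birational s hs hsh)
    hirr ⟨x, hx, hsm⟩
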